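/- A functor $p:\mathsf{Set}\to\mathsf{Set}$ is polynomial if $p\cong\sum_{P\in I}\mathcal y^{A_P}$ for some set $I$ and sets $A_P$, where $\mathcal y^A=\mathsf{Set}(A,-)$; one may take $I=p(1)$ and one writes $p[P]=A_P$. Let $\mathsf{Poly}$ be the category of polynomial functors and natural transformations and $\mathcal y$ the identity functor. Let $\otimes$ be the Dirichlet product $$p\otimes q=\sum_{(P,Q)\in p(1)\times q(1)}\mathcal y^{p[P]\times q[Q]}$$ with unit $\mathcal y$ (the Day convolution of the cartesian product of sets), and let $\triangleleft$ be the substitution product $p\triangleleft q=p\circ q$ with unit $\mathcal y$. Each of them makes $\mathsf{Poly}$ a monoidal category. **Corollary.** $(\mathsf{Poly},\mathcal y,\otimes,\triangleleft)$ is an isomix non-planar linearly distributive category. Here, for a category with two monoidal structures $(\otimes,\top)$ and $(\triangleleft,\bot)$: * It is *linearly distributive* if it is equipped with natural transformations (linear distributors) $$\partial^L_L: a\otimes(b\triangleleft c)\to(a\otimes b)\triangleleft c,\qquad \partial^R_R:(b\triangleleft c)\otimes a\to b\triangleleft(c\otimes a)$$ that are coherent with the units and associators of both products and with each other: each distributor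 with $a=\top$, and $\partial^L_L$ with $c=\bot$ and $\partial^R_R$ with $b=\bot$, is compatible with the unitors; each distributor is compatible with the associators of $\otimes$ and of $\triangleleft$; and the two composites of $\partial^L_L$ and $\partial^R_R$ from $a\otimes(b\triangleleft c)\otimes d$ to $(a\otimes b)\triangleleft(c\otimes d)$, and from $(a\triangleleft b)\otimes(c\triangleleft d)$ to $a\triangleleft(b\otimes c)\triangleleft d$, agree up to associators. * It is *non-planar* if it is moreover equipped with natural permuting distributors $$\partial^L_R: a\otimes(b\triangleleft c)\to b\triangleleft(a\otimes c),\qquad \partial^R_L:(b\triangleleft c)\otimes a\to(b\otimes a)\triangleleft c,$$ which satisfy the analogous compatibilities with unitors and associators, and all four distributors are mutually compatible: whenever two of them can be applied one after the other, in either order, to $a\otimes(b\triangleleft c)\otimes d$, to $a\otimes(b\triangleleft c\triangleleft d)$, to $(b\triangleleft c\triangleleft d)\otimes a$ or to $(a\triangleleft b)\otimes(c\triangleleft d)$ with the same target up to associators, the two composites agree. * It is *mix* if it is linearly distributive and equipped with a map $\mathsf m:\bot\to\top$ such that for all $a,b$ the two maps $a\otimes b\to a\triangleleft b$ given by $$a\otimes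 b\cong a\otimes(\bot\triangleleft b)\xrightarrow{\mathsf m}a\otimes(\top\triangleleft b)\xrightarrow{\partial^L_L}(a\otimes\top)\triangleleft b\cong a\triangleleft b,$$ $$a\otimes b\cong(a\triangleleft\bot)\otimes b\xrightarrow{\partial^R_R}a\triangleleft(\bot\otimes b)\xrightarrow{\mathsf m}a\triangleleft(\top\otimes b)\cong a\triangleleft b$$ agree. It is *isomix* if moreover $\mathsf m$ is an isomorphism. -/

import Mathlib

open CategoryTheory

universe u

/-! ### Linearly distributive categories

A category `C` with two monoidal structures `T` (the tensor `⊗`, with unit `⊤`) and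
`S` (the second product `◁`, with unit `⊥`). -/

notation:70 a:71 " ⊗[" T "] " b:71 =>
  MonoidalCategoryStruct.tensorObj (self := MonoidalCategory.toMonoidalCategoryStruct (self := T)) a b

/-- A linearly distributive category: the two linear distributors, natural in all three variables,
with their coherence conditions (four for the units, two for associativity of `⊗`, two for
associativity of `◁`, and two relating the left distributor to the right one). -/
structure LDC (C : Type*) [Category C] (T S : MonoidalCategory C) where
  /-- `a ⊗ (b ◁ c) ⟶ (a ⊗ b) ◁ c` -/
  distL (a b c : C) : a ⊗[T] (b ⊗[S] c) ⟶ (a ⊗[T] b) ⊗[S] c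
  /-- `(b ◁ c) ⊗ a ⟶ b ◁ (c ⊗ a)` -/
  distR (b c a : C) : (b ⊗[S] c) ⊗[T] a ⟶ b ⊗[S] (c ⊗[T] a)
  distL_natural {a b c a' b' c' : C} (f : a ⟶ a') (g : b ⟶ b') (h : c ⟶ c') :
    T.tensorHom f (S.tensorHom g h) ≫ distL a' b' c' =
      distL a b c ≫ S.tensorHom (T.tensorHom f g) h
  distR_natural {b c a b' c' a' : C} (g : b ⟶ b') (h : c ⟶ c') (f : a ⟶ a') :
    T.tensorHom (S.tensorHom g h) f ≫ distR b' c' a' =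
      distR b c a ≫ S.tensorHom g (T.tensorHom h f)
  distL_top (b c : C) :
    distL T.tensorUnit b c ≫ S.whiskerRight (T.leftUnitor b).hom c =
      (T.leftUnitor (b ⊗[S] c)).hom
  distL_bot (a b : C) :
    distL a b S.tensorUnit ≫ (S.rightUnitor (a ⊗[T] b)).hom =
      T.whiskerLeft a (S.rightUnitor b).hom
  distR_top (b c : C) :
    distR b c T.tensorUnit ≫ S.whiskerLeft b (T.rightUnitor c).hom =
      (T.rightUnitor (b ⊗[S] c)).hom
  distR_bot (c a : C) :
    distR S.tensorUnit c a ≫ (S.leftUnitor (c ⊗[T] a)).hom =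
      T.whiskerRight (S.leftUnitor c).hom a
  /-- from `(a ⊗ b) ⊗ (c ◁ d)` to `(a ⊗ (b ⊗ c)) ◁ d` -/
  distL_assoc_tensor (a b c d : C) :
    distL (a ⊗[T] b) c d ≫ S.whiskerRight (T.associator a b c).hom d =
      (T.associator a b (c ⊗[S] d)).hom ≫ T.whiskerLeft a (distL b c d) ≫
        distL a (b ⊗[T] c) d
  /-- from `((c ◁ d) ⊗ a) ⊗ b` to `c ◁ (d ⊗ (a ⊗ b))` -/
  distR_assoc_tensor (c d a b : C) :
    T.whiskerRight (distR c d a) b ≫ distR c (d ⊗[T] a) b ≫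
        S.whiskerLeft c (T.associator d a b).hom =
      (T.associator (c ⊗[S] d) a b).hom ≫ distR c d (a ⊗[T] b)
  /-- from `a ⊗ ((b ◁ c) ◁ d)` to `(a ⊗ b) ◁ (c ◁ d)` -/
  distL_assoc_seq (a b c d : C) :
    distL a (b ⊗[S] c) d ≫ S.whiskerRight (distL a b c) d ≫
        (S.associator (a ⊗[T] b) c d).hom =
      T.whiskerLeft a (S.associator b c d).hom ≫ distL a b (c ⊗[S] d)
  /-- from `((b ◁ c) ◁ d) ⊗ a` to `b ◁ (c ◁ (d ⊗ a))` -/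
  distR_assoc_seq (b c d a : C) :
    distR (b ⊗[S] c) d a ≫ (S.associator b c (d ⊗[T] a)).hom =
      T.whiskerRight (S.associator b c d).hom a ≫ distR b (c ⊗[S] d) a ≫
        S.whiskerLeft b (distR c d a)
  /-- from `(a ⊗ (b ◁ c)) ⊗ d` to `(a ⊗ b) ◁ (c ⊗ d)` -/
  distL_distR_tensor (a b c d : C) :
    T.whiskerRight (distL a b c) d ≫ distR (a ⊗[T] b) c d =
      (T.associator a (b ⊗[S] c) d).hom ≫ T.whiskerLeft a (distR b c d) ≫
        distL a b (c ⊗[T] d)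
  /-- from `(a ◁ b) ⊗ (c ◁ d)` to `a ◁ ((b ⊗ c) ◁ d)` -/
  distL_distR_seq (a b c d : C) :
    distL (a ⊗[S] b) c d ≫ S.whiskerRight (distR a b c) d ≫
        (S.associator a (b ⊗[T] c) d).hom =
      distR a b (c ⊗[S] d) ≫ S.whiskerLeft a (distL b c d)

/-- A non-planar linearly distributive category: it has in addition the two permuting distributors,
and all four distributors are coherent with the units and associators and with each other
(in every way that is well typed without a symmetry). -/
structure NonplanarLDC (C : Type*) [Category C] (T S : MonoidalCategory C) extends LDC C T S where
  /-- `a ⊗ (b ◁ c) ⟶ b ◁ (a ⊗ c)` -/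
  distLR (a b c : C) : a ⊗[T] (b ⊗[S] c) ⟶ b ⊗[S] (a ⊗[T] c)
  /-- `(b ◁ c) ⊗ a ⟶ (b ⊗ a) ◁ c` -/
  distRL (b c a : C) : (b ⊗[S] c) ⊗[T] a ⟶ (b ⊗[T] a) ⊗[S] c
  distLR_natural {a b c a' b' c' : C} (f : a ⟶ a') (g : b ⟶ b') (h : c ⟶ c') :
    T.tensorHom f (S.tensorHom g h) ≫ distLR a' b' c' =
      distLR a b c ≫ S.tensorHom g (T.tensorHom f h)
  distRL_natural {b c a b' c' a' : C} (g : b ⟶ b') (h : c ⟶ c') (f : a ⟶ a') :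
    T.tensorHom (S.tensorHom g h) f ≫ distRL b' c' a' =
      distRL b c a ≫ S.tensorHom (T.tensorHom g f) h
  distLR_top (b c : C) :
    distLR T.tensorUnit b c ≫ S.whiskerLeft b (T.leftUnitor c).hom =
      (T.leftUnitor (b ⊗[S] c)).hom
  distLR_bot (a c : C) :
    distLR a S.tensorUnit c ≫ (S.leftUnitor (a ⊗[T] c)).hom =
      T.whiskerLeft a (S.leftUnitor c).hom
  distRL_top (b c : C) :
    distRL b c T.tensorUnit ≫ S.whiskerRight (T.rightUnitor b).hom c =
      (T.rightUnitor (b ⊗[S] c)).hom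
  distRL_bot (b a : C) :
    distRL b S.tensorUnit a ≫ (S.rightUnitor (b ⊗[T] a)).hom =
      T.whiskerRight (S.rightUnitor b).hom a
  /-- from `(a ⊗ b) ⊗ (c ◁ d)` to `c ◁ (a ⊗ (b ⊗ d))` -/
  distLR_assoc_tensor (a b c d : C) :
    distLR (a ⊗[T] b) c d ≫ S.whiskerLeft c (T.associator a b d).hom =
      (T.associator a b (c ⊗[S] d)).hom ≫ T.whiskerLeft a (distLR b c d) ≫
        distLR a c (b ⊗[T] d)
  /-- from `((c ◁ d) ⊗ a) ⊗ b` to `(c ⊗ (a ⊗ b)) ◁ d` -/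
  distRL_assoc_tensor (c d a b : C) :
    T.whiskerRight (distRL c d a) b ≫ distRL (c ⊗[T] a) d b ≫
        S.whiskerRight (T.associator c a b).hom d =
      (T.associator (c ⊗[S] d) a b).hom ≫ distRL c d (a ⊗[T] b)
  /-- from `(a ⊗ (b ◁ c)) ⊗ d` to `(a ⊗ (b ⊗ d)) ◁ c` -/
  distL_distRL_tensor (a b c d : C) :
    T.whiskerRight (distL a b c) d ≫ distRL (a ⊗[T] b) c d ≫
        S.whiskerRight (T.associator a b d).hom c =
      (T.associator a (b ⊗[S] c) d).hom ≫ T.whiskerLeft a (distRL b c d) ≫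
        distL a (b ⊗[T] d) c
  /-- from `(a ⊗ (b ◁ c)) ⊗ d` to `b ◁ (a ⊗ (c ⊗ d))` -/
  distLR_distR_tensor (a b c d : C) :
    T.whiskerRight (distLR a b c) d ≫ distR b (a ⊗[T] c) d ≫
        S.whiskerLeft b (T.associator a c d).hom =
      (T.associator a (b ⊗[S] c) d).hom ≫ T.whiskerLeft a (distR b c d) ≫
        distLR a b (c ⊗[T] d)
  /-- from `(a ⊗ (b ◁ c)) ⊗ d` to `(b ⊗ d) ◁ (a ⊗ c)` -/
  distLR_distRL_tensor (a b c d : C) :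
    T.whiskerRight (distLR a b c) d ≫ distRL b (a ⊗[T] c) d =
      (T.associator a (b ⊗[S] c) d).hom ≫ T.whiskerLeft a (distRL b c d) ≫
        distLR a (b ⊗[T] d) c
  /-- from `a ⊗ ((b ◁ c) ◁ d)` to `b ◁ (c ◁ (a ⊗ d))` -/
  distLR_assoc_seq (a b c d : C) :
    distLR a (b ⊗[S] c) d ≫ (S.associator b c (a ⊗[T] d)).hom =
      T.whiskerLeft a (S.associator b c d).hom ≫ distLR a b (c ⊗[S] d) ≫
        S.whiskerLeft b (distLR a c d)
  /-- from `((b ◁ c) ◁ d) ⊗ a` to `(b ⊗ a) ◁ (c ◁ d)` -/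
  distRL_assoc_seq (b c d a : C) :
    distRL (b ⊗[S] c) d a ≫ S.whiskerRight (distRL b c a) d ≫
        (S.associator (b ⊗[T] a) c d).hom =
      T.whiskerRight (S.associator b c d).hom a ≫ distRL b (c ⊗[S] d) a
  /-- from `a ⊗ ((b ◁ c) ◁ d)` to `b ◁ ((a ⊗ c) ◁ d)` -/
  distL_distLR_seq (a b c d : C) :
    distL a (b ⊗[S] c) d ≫ S.whiskerRight (distLR a b c) d ≫
        (S.associator b (a ⊗[T] c) d).hom =
      T.whiskerLeft a (S.associator b c d).hom ≫ distLR a b (c ⊗[S] d) ≫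
        S.whiskerLeft b (distL a c d)
  /-- from `((b ◁ c) ◁ d) ⊗ a` to `b ◁ ((c ⊗ a) ◁ d)` -/
  distR_distRL_seq (b c d a : C) :
    distRL (b ⊗[S] c) d a ≫ S.whiskerRight (distR b c a) d ≫
        (S.associator b (c ⊗[T] a) d).hom =
      T.whiskerRight (S.associator b c d).hom a ≫ distR b (c ⊗[S] d) a ≫
        S.whiskerLeft b (distRL c d a)
  /-- from `(a ◁ b) ⊗ (c ◁ d)` to `c ◁ ((a ⊗ d) ◁ b)` -/
  distLR_distRL_seq (a b c d : C) :
    distRL a b (c ⊗[S] d) ≫ S.whiskerRight (distLR a c d) b ≫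
        (S.associator c (a ⊗[T] d) b).hom =
      distLR (a ⊗[S] b) c d ≫ S.whiskerLeft c (distRL a b d)

/-- `m : ⊥ ⟶ ⊤` is a mix map: the two maps `a ⊗ b ⟶ a ◁ b` that it induces through the left and the
right linear distributor agree. -/
def LDC.IsMixMap {C : Type*} [Category C] {T S : MonoidalCategory C} (L : LDC C T S)
    (m : S.tensorUnit ⟶ T.tensorUnit) : Prop :=
  ∀ a b : C,
    T.whiskerLeft a (S.leftUnitor b).inv ≫ T.whiskerLeft a (S.whiskerRight m b) ≫
        L.distL a T.tensorUnit b ≫ S.whiskerRight (T.rightUnitor a).hom b =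
      T.whiskerRight (S.rightUnitor a).inv b ≫ L.distR a S.tensorUnit b ≫
        S.whiskerLeft a (T.whiskerRight m b) ≫ S.whiskerLeft a (T.leftUnitor b).hom

/-! ### Polynomial functors -/

/-- The coproduct of representables `∑ i, y ^ A i`, that is `X ↦ Σ i, (A i → X)`. -/
@[simps]
def sumRepresentable {I : Type u} (A : I → Type u) : Type u ⥤ Type u where
  obj X := Σ i, (A i → X)
  map f := TypeCat.ofHom fun x => ⟨x.1, fun d => f (x.2 d)⟩

/-- A functor `Set ⥤ Set` is polynomial if it is isomorphic to a coproduct of representables. -/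
def IsPolynomial : ObjectProperty (Type u ⥤ Type u) := fun F =>
  ∃ (I : Type u) (A : I → Type u), Nonempty (F ≅ sumRepresentable A)

/-- The category of polynomial functors `Set ⥤ Set` and natural transformations. -/
abbrev PolyFunctor : Type (u + 1) := IsPolynomial.{u}.FullSubcategory

namespace PolyFunctor

/-- The value `p(A)`. -/
abbrev ev (p : PolyFunctor.{u}) (A : Type u) : Type u := p.obj.obj A

/-- The action of a polynomial functor on functions. -/
def act (p : PolyFunctor.{u}) {A B : Type u} (f : A → B) (x : p.ev A) : p.ev B :=
  p.obj.map (TypeCat.ofHom f) x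

/-- The component of a natural transformation. -/
def app {p q : PolyFunctor.{u}} (φ : p ⟶ q) (A : Type u) (x : p.ev A) : q.ev A := φ.hom.app A x

/-- A natural transformation from its components. -/
def mkHom {p q : PolyFunctor.{u}} (φ : ∀ A, p.ev A → q.ev A)
    (h : ∀ (A B : Type u) (f : A → B) (x : p.ev A), φ B (p.act f x) = q.act f (φ A x)) :
    p ⟶ q :=
  ObjectProperty.homMk
    { app := fun A => TypeCat.ofHom (φ A)
      naturality := fun A B f => by
        ext x
        exact h A B f x }

theorem act_id (p : PolyFunctor.{u}) {A : Type u} (x : p.ev A) : p.act (fun a => a) x = x :=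
  p.obj.map_id_apply A x

theorem act_act (p : PolyFunctor.{u}) {A B C : Type u} (f : A → B) (g : B → C) (x : p.ev A) :
    p.act g (p.act f x) = p.act (fun a => g (f a)) x :=
  (p.obj.map_comp_apply (TypeCat.ofHom f) (TypeCat.ofHom g) x).symm

theorem app_act {p q : PolyFunctor.{u}} (φ : p ⟶ q) {A B : Type u} (f : A → B) (x : p.ev A) :
    app φ B (p.act f x) = q.act f (app φ A x) :=
  NatTrans.naturality_apply φ.hom (TypeCat.ofHom f) x

@[simp]
theorem app_mkHom {p q : PolyFunctor.{u}} (φ : ∀ A, p.ev A → q.ev A) (h) (A : Type u) (x : p.ev A) :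
    app (mkHom φ h) A x = φ A x := rfl

@[simp]
theorem app_id (p : PolyFunctor.{u}) (A : Type u) (x : p.ev A) : app (𝟙 p) A x = x := rfl

@[simp]
theorem app_comp {p q r : PolyFunctor.{u}} (φ : p ⟶ q) (ψ : q ⟶ r) (A : Type u) (x : p.ev A) :
    app (φ ≫ ψ) A x = app ψ A (app φ A x) := rfl

theorem app_id_fun (p : PolyFunctor.{u}) (A : Type u) : app (𝟙 p) A = fun x => x := rfl

theorem app_comp_fun {p q r : PolyFunctor.{u}} (φ : p ⟶ q) (ψ : q ⟶ r) (A : Type u) :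
    app (φ ≫ ψ) A = fun x => app ψ A (app φ A x) := rfl

theorem hom_ext' {p q : PolyFunctor.{u}} {φ ψ : p ⟶ q} (h : ∀ A x, app φ A x = app ψ A x) : φ = ψ := by
  apply ObjectProperty.hom_ext
  ext A x
  exact h A x

/-- The positions `p(1)` of a polynomial functor (in a chosen presentation). -/
def pos (p : PolyFunctor.{u}) : Type u := p.property.choose

/-- The directions `p[P]` at a position `P`. -/
def dir (p : PolyFunctor.{u}) : p.pos → Type u := p.property.choose_spec.choose

/-- The isomorphism `p ≅ ∑ P, y ^ p[P]`. -/
noncomputable def pres (p : PolyFunctor.{u}) : p.obj ≅ sumRepresentable p.dir :=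
  p.property.choose_spec.choose_spec.some

/-- The unit `y`, the identity functor. -/
def y : PolyFunctor.{u} where
  obj := 𝟭 (Type u)
  property := ⟨PUnit, fun _ => PUnit, ⟨NatIso.ofComponents
    (fun _ => (Equiv.toIso
      { toFun := fun x => ⟨PUnit.unit, fun _ => x⟩
        invFun := fun x => x.2 PUnit.unit
        left_inv := fun _ => rfl
        right_inv := fun _ => rfl }))
    (fun _ => rfl)⟩⟩

/-! #### The substitution product -/

/-- The substitution product `p ◁ q`, that is the composite functor `X ↦ p(q(X))`, which is again
polynomial: it is isomorphic to `∑ (P, Q : p[P] → q(1)), y ^ (∑ d, q[Q d])`. -/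
def subst (p q : PolyFunctor.{u}) : PolyFunctor.{u} where
  obj := q.obj ⋙ p.obj
  property := ⟨Σ P : p.pos, (p.dir P → q.pos), fun i => Σ d : p.dir i.1, q.dir (i.2 d),
    ⟨Functor.isoWhiskerRight q.pres p.obj ≪≫ Functor.isoWhiskerLeft (sumRepresentable q.dir) p.pres
      ≪≫ NatIso.ofComponents
      (fun _ => (Equiv.toIso
        { toFun := fun x => ⟨⟨x.1, fun d => (x.2 d).1⟩, fun e => (x.2 e.1).2 e.2⟩
          invFun := fun x => ⟨x.1.1, fun d => ⟨x.1.2 d, fun e => x.2 ⟨d, e⟩⟩⟩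
          left_inv := fun _ => rfl
          right_inv := fun _ => rfl }))
      (fun _ => rfl)⟩⟩

/-- The substitution product of natural transformations (horizontal composition). -/
def substMap {p p' q q' : PolyFunctor.{u}} (φ : p ⟶ p') (ψ : q ⟶ q') : subst p q ⟶ subst p' q' :=
  ObjectProperty.homMk (ψ.hom ◫ φ.hom)

@[simp]
theorem app_substMap {p p' q q' : PolyFunctor.{u}} (φ : p ⟶ p') (ψ : q ⟶ q') (A : Type u)
    (x : (subst p q).ev A) :
    app (substMap φ ψ) A x = p'.act (app ψ A) (app φ (q.ev A) x) :=
  rfl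

@[simp]
theorem app_substMap' {p p' q q' : PolyFunctor.{u}} (φ : p ⟶ p') (ψ : q ⟶ q') (A : Type u)
    (x : p.ev (q.ev A)) :
    app (substMap φ ψ) A x = p'.act (app ψ A) (app φ (q.ev A) x) :=
  rfl

/-- The monoidal structure `(Poly, y, ◁)`. -/
@[reducible]
def substitution : MonoidalCategory PolyFunctor.{u} where
  tensorObj := subst
  tensorHom φ ψ := substMap φ ψ
  whiskerLeft p _ _ ψ := substMap (𝟙 p) ψ
  whiskerRight φ q := substMap φ (𝟙 q)
  tensorUnit := y
  associator p q r := ObjectProperty.isoMk _ (Functor.associator r.obj q.obj p.obj).symm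
  leftUnitor p := ObjectProperty.isoMk _ (Functor.rightUnitor p.obj)
  rightUnitor p := ObjectProperty.isoMk _ (Functor.leftUnitor p.obj)
  tensorHom_def φ ψ := hom_ext' fun A x => by
    simp only [app_comp, app_substMap, app_substMap', app_id_fun, act_id]; rfl
  id_tensorHom_id p q := hom_ext' fun A x => p.act_id x
  tensorHom_comp_tensorHom f g h k := hom_ext' fun A x => by
    simp only [app_comp, app_substMap, app_substMap', app_act, act_act, app_comp_fun]; rfl
  whiskerLeft_id p q := hom_ext' fun A x => p.act_id x
  id_whiskerRight p q := hom_ext' fun A x => p.act_id x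
  associator_naturality {_ _ _ p _ _} φ ψ χ := hom_ext' fun A x =>
    p.act_act _ _ (app φ _ x)
  leftUnitor_naturality φ := hom_ext' fun A x => rfl
  rightUnitor_naturality φ := hom_ext' fun A x => act_id _ _
  pentagon p q r s := hom_ext' fun A x => by
    simp only [app_comp, app_substMap, app_id_fun, act_id]
    exact p.act_id x
  triangle p q := hom_ext' fun A x => rfl

/-! #### The Dirichlet product -/

/-- The Dirichlet product `p ⊗ q = ∑ (P, Q), y ^ (p[P] × q[Q])`, for the chosen presentations of
`p` and `q`; it is the Day convolution of the cartesian product of sets (see `day` below). -/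
def dirichlet (p q : PolyFunctor.{u}) : PolyFunctor.{u} where
  obj := sumRepresentable fun i : p.pos × q.pos => p.dir i.1 × q.dir i.2
  property := ⟨_, _, ⟨Iso.refl _⟩⟩

/-- The universal map `p(A) × q(B) → (p ⊗ q)(A × B)` of the Dirichlet product as a Day
convolution. -/
noncomputable def day {p q : PolyFunctor.{u}} {A B : Type u} (x : p.ev A) (z : q.ev B) :
    (dirichlet p q).ev (A × B) :=
  ⟨((p.pres.hom.app A x).1, (q.pres.hom.app B z).1),
    fun d => ((p.pres.hom.app A x).2 d.1, (q.pres.hom.app B z).2 d.2)⟩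

/-- The element of `p(p[P])` corresponding to the position `P`. -/
noncomputable def gen (p : PolyFunctor.{u}) (P : p.pos) : p.ev (p.dir P) :=
  p.pres.inv.app (p.dir P) ⟨P, fun d => d⟩

theorem pres_hom_act (p : PolyFunctor.{u}) {A B : Type u} (f : A → B) (x : p.ev A) :
    p.pres.hom.app B (p.act f x) =
      ⟨(p.pres.hom.app A x).1, fun d => f ((p.pres.hom.app A x).2 d)⟩ :=
  NatTrans.naturality_apply p.pres.hom (TypeCat.ofHom f) x

theorem pres_hom_gen (p : PolyFunctor.{u}) (P : p.pos) :
    p.pres.hom.app (p.dir P) (p.gen P) = ⟨P, fun d => d⟩ :=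
  Iso.inv_hom_id_app_apply p.pres (p.dir P) _

theorem act_gen (p : PolyFunctor.{u}) {A : Type u} (x : p.ev A) :
    p.act (p.pres.hom.app A x).2 (p.gen (p.pres.hom.app A x).1) = x := by
  have h : p.pres.hom.app A (p.act (p.pres.hom.app A x).2 (p.gen (p.pres.hom.app A x).1)) =
      p.pres.hom.app A x := by
    rw [pres_hom_act, pres_hom_gen]
    rfl
  have h' := congrArg (p.pres.inv.app A) h
  rwa [Iso.hom_inv_id_app_apply, Iso.hom_inv_id_app_apply] at h'

theorem act_day {p q : PolyFunctor.{u}} {A B A' B' : Type u} (f : A → A') (g : B → B')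
    (x : p.ev A) (z : q.ev B) :
    (dirichlet p q).act (fun t => (f t.1, g t.2)) (day x z) = day (p.act f x) (q.act g z) := by
  unfold day
  rw [pres_hom_act, pres_hom_act]
  rfl

theorem eq_act_day {p q : PolyFunctor.{u}} {X : Type u} (w : (dirichlet p q).ev X) :
    w = (dirichlet p q).act w.2 (day (p.gen w.1.1) (q.gen w.1.2)) := by
  unfold day
  rw [pres_hom_gen, pres_hom_gen]
  rfl

theorem day_act_left {p q : PolyFunctor.{u}} {A B A' : Type u} (f : A → A')
    (x : p.ev A) (z : q.ev B) :
    day (p.act f x) z = (dirichlet p q).act (fun t => (f t.1, t.2)) (day x z) := by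
  rw [act_day f (fun b => b) x z, act_id]

theorem day_act_right {p q : PolyFunctor.{u}} {A B B' : Type u} (g : B → B')
    (x : p.ev A) (z : q.ev B) :
    day x (q.act g z) = (dirichlet p q).act (fun t => (t.1, g t.2)) (day x z) := by
  rw [act_day (fun a => a) g x z, act_id]

/-- Maps out of `p ⊗ q` are determined by their values on the universal map. -/
theorem dirichlet_ext {p q r : PolyFunctor.{u}} {φ ψ : dirichlet p q ⟶ r}
    (h : ∀ (A B : Type u) (x : p.ev A) (z : q.ev B),
      app φ (A × B) (day x z) = app ψ (A × B) (day x z)) : φ = ψ :=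
  hom_ext' fun X w => by
    rw [eq_act_day w, app_act, app_act, h]

theorem dirichlet_ext_left {p q r s : PolyFunctor.{u}} {φ ψ : dirichlet (dirichlet p q) r ⟶ s}
    (h : ∀ (A B C : Type u) (x : p.ev A) (z : q.ev B) (w : r.ev C),
      app φ _ (day (day x z) w) = app ψ _ (day (day x z) w)) : φ = ψ :=
  dirichlet_ext fun A B x z => by
    rw [eq_act_day x, day_act_left, app_act, app_act, h]

theorem dirichlet_ext_left' {p q r s t : PolyFunctor.{u}}
    {φ ψ : dirichlet (dirichlet (dirichlet p q) r) s ⟶ t}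
    (h : ∀ (A B C D : Type u) (x : p.ev A) (z : q.ev B) (w : r.ev C) (v : s.ev D),
      app φ _ (day (day (day x z) w) v) = app ψ _ (day (day (day x z) w) v)) : φ = ψ :=
  dirichlet_ext_left fun A B C x z w => by
    rw [eq_act_day x, day_act_left, day_act_left, app_act, app_act, h]

theorem dirichlet_ext_right {p q r s : PolyFunctor.{u}} {φ ψ : dirichlet p (dirichlet q r) ⟶ s}
    (h : ∀ (A B C : Type u) (x : p.ev A) (z : q.ev B) (w : r.ev C),
      app φ _ (day x (day z w)) = app ψ _ (day x (day z w))) : φ = ψ :=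
  dirichlet_ext fun A B x z => by
    rw [eq_act_day z, day_act_right, app_act, app_act, h]

/-- Elimination of an element of `(p ⊗ q)(X)`, which is of the form
`(p ⊗ q)(h)(day x z)`. -/
noncomputable def elim {p q : PolyFunctor.{u}} {X : Type u} {Z : Sort*}
    (G : ∀ {A B : Type u}, p.ev A → q.ev B → (A × B → X) → Z) (w : (dirichlet p q).ev X) : Z :=
  G (p.gen w.1.1) (q.gen w.1.2) w.2

theorem elim_day {p q : PolyFunctor.{u}} {A B : Type u} {Z : Sort*}
    (G : ∀ {A' B' : Type u}, p.ev A' → q.ev B' → (A' × B' → A × B) → Z)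
    (hG : ∀ {A' B' A'' B'' : Type u} (f : A' → A'') (g : B' → B'') (x : p.ev A') (z : q.ev B')
      (h : A'' × B'' → A × B), G (p.act f x) (q.act g z) h = G x z (fun t => h (f t.1, g t.2)))
    (x : p.ev A) (z : q.ev B) : elim G (day x z) = G x z (fun t => t) := by
  have h' := hG (p.pres.hom.app A x).2 (q.pres.hom.app B z).2 (p.gen (p.pres.hom.app A x).1)
    (q.gen (q.pres.hom.app B z).1) (fun t => t)
  rw [act_gen, act_gen] at h'
  exact h'.symm

/-- The map out of `p ⊗ q` given by the universal property of Day convolution: a family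
`p(A) × q(B) → r(A × B)` natural in `A` and `B` extends uniquely along `day`. -/
noncomputable def desc {p q r : PolyFunctor.{u}}
    (φ : ∀ {A B : Type u}, p.ev A → q.ev B → r.ev (A × B)) : dirichlet p q ⟶ r :=
  mkHom (fun _ w => elim (fun x z h => r.act h (φ x z)) w) (fun _ _ f w => (r.act_act w.2 f _).symm)

theorem app_desc_day {p q r : PolyFunctor.{u}}
    (φ : ∀ {A B : Type u}, p.ev A → q.ev B → r.ev (A × B))
    (h : ∀ {A B A' B' : Type u} (f : A → A') (g : B → B') (x : p.ev A) (z : q.ev B),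
      φ (p.act f x) (q.act g z) = r.act (fun t => (f t.1, g t.2)) (φ x z))
    {A B : Type u} (x : p.ev A) (z : q.ev B) :
    app (desc φ) (A × B) (day x z) = φ x z := by
  refine (elim_day (fun x z h => r.act h (φ x z)) ?_ x z).trans (r.act_id _)
  intro _ _ _ _ f g x z k
  rw [h, act_act]

/-- The Dirichlet product of natural transformations. -/
noncomputable def dirichletMap {p p' q q' : PolyFunctor.{u}} (φ : p ⟶ p') (ψ : q ⟶ q') :
    dirichlet p q ⟶ dirichlet p' q' :=
  desc fun {A B} x z => day (app φ A x) (app ψ B z)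

@[simp]
theorem dirichletMap_day {p p' q q' : PolyFunctor.{u}} (φ : p ⟶ p') (ψ : q ⟶ q')
    {A B : Type u} (x : p.ev A) (z : q.ev B) :
    app (dirichletMap φ ψ) (A × B) (day x z) = day (app φ A x) (app ψ B z) :=
  app_desc_day _ (fun f g x z => by rw [app_act, app_act, act_day]) x z

/-- The associator on elements: `((x, z), w) ↦ (x, (z, w))`. -/
noncomputable def dirichletAssocHom (p q r : PolyFunctor.{u}) :
    dirichlet (dirichlet p q) r ⟶ dirichlet p (dirichlet q r) :=
  desc fun v w => elim (fun x z h =>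
    (dirichlet p (dirichlet q r)).act (fun t => (h (t.1, t.2.1), t.2.2)) (day x (day z w))) v

@[simp]
theorem dirichletAssocHom_day (p q r : PolyFunctor.{u}) {A B C : Type u}
    (x : p.ev A) (z : q.ev B) (w : r.ev C) :
    app (dirichletAssocHom p q r) _ (day (day x z) w) =
      (dirichlet p (dirichlet q r)).act (fun t => ((t.1, t.2.1), t.2.2)) (day x (day z w)) := by
  refine (app_desc_day _ ?_ _ _).trans (elim_day _ ?_ x z)
  · intro A B A' B' f g v w
    rw [eq_act_day v, act_act]
    simp only [elim, day_act_right, act_act]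
    rfl
  · intro _ _ _ _ f g x z h
    simp only [day_act_left, day_act_right, act_act]

/-- The inverse of the associator on elements: `(x, (z, w)) ↦ ((x, z), w)`. -/
noncomputable def dirichletAssocInv (p q r : PolyFunctor.{u}) :
    dirichlet p (dirichlet q r) ⟶ dirichlet (dirichlet p q) r :=
  desc fun x v => elim (fun z w h =>
    (dirichlet (dirichlet p q) r).act (fun t => (t.1.1, h (t.1.2, t.2))) (day (day x z) w)) v

@[simp]
theorem dirichletAssocInv_day (p q r : PolyFunctor.{u}) {A B C : Type u}
    (x : p.ev A) (z : q.ev B) (w : r.ev C) :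
    app (dirichletAssocInv p q r) _ (day x (day z w)) =
      (dirichlet (dirichlet p q) r).act (fun t => (t.1.1, (t.1.2, t.2))) (day (day x z) w) := by
  refine (app_desc_day _ ?_ _ _).trans (elim_day _ ?_ z w)
  · intro A B A' B' f g x v
    rw [eq_act_day v, act_act]
    simp only [elim, day_act_left, act_act]
    rfl
  · intro _ _ _ _ f g x z h
    simp only [day_act_left, day_act_right, act_act]

/-- The associator of the Dirichlet product. -/
noncomputable def dirichletAssoc (p q r : PolyFunctor.{u}) :
    dirichlet (dirichlet p q) r ≅ dirichlet p (dirichlet q r) where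
  hom := dirichletAssocHom p q r
  inv := dirichletAssocInv p q r
  hom_inv_id := dirichlet_ext_left fun A B C x z w => by
    simp only [app_comp, app_id, dirichletAssocHom_day, app_act, dirichletAssocInv_day, act_act]
    exact act_id _ _
  inv_hom_id := dirichlet_ext_right fun A B C x z w => by
    simp only [app_comp, app_id, dirichletAssocHom_day, app_act, dirichletAssocInv_day, act_act]
    exact act_id _ _

/-- The element of `y(1)`. -/
def pt : y.ev PUnit.{u + 1} := PUnit.unit

/-- The underlying element of an element of `y(A)`. -/
def val {A : Type u} (a : y.ev A) : A := a

theorem act_pt {A : Type u} (a : y.ev A) : y.act (fun _ => val a) pt = a := rfl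

theorem val_act {A B : Type u} (f : A → B) (a : y.ev A) : val (y.act f a) = f (val a) := rfl

/-- The left unitor on elements: `(a, z) ↦ q(b ↦ (a, b))(z)`. -/
noncomputable def dirichletLeftUnitorHom (q : PolyFunctor.{u}) : dirichlet y q ⟶ q :=
  desc fun a z => q.act (fun b => (val a, b)) z

@[simp]
theorem dirichletLeftUnitorHom_day (q : PolyFunctor.{u}) {A B : Type u} (a : y.ev A)
    (z : q.ev B) :
    app (dirichletLeftUnitorHom q) _ (day a z) = q.act (fun b => (val a, b)) z :=
  app_desc_day _ (fun f g a z => by simp only [act_act, val_act]) a z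

/-- The left unitor of the Dirichlet product. -/
noncomputable def dirichletLeftUnitor (q : PolyFunctor.{u}) : dirichlet y q ≅ q where
  hom := dirichletLeftUnitorHom q
  inv := mkHom (fun A z => (dirichlet y q).act (fun t => t.2) (day pt z))
    (fun A B f z => by rw [day_act_right, act_act, act_act])
  hom_inv_id := dirichlet_ext fun A B a z => by
    conv_rhs => rw [← act_pt a]
    simp only [app_comp, app_id, dirichletLeftUnitorHom_day, app_mkHom, day_act_right,
      day_act_left, act_act]
  inv_hom_id := hom_ext' fun A x => by
    simp only [app_comp, app_id, dirichletLeftUnitorHom_day, app_mkHom, app_act, act_act, act_id]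

/-- The right unitor on elements: `(x, b) ↦ p(a ↦ (a, b))(x)`. -/
noncomputable def dirichletRightUnitorHom (p : PolyFunctor.{u}) : dirichlet p y ⟶ p :=
  desc fun x b => p.act (fun a => (a, val b)) x

@[simp]
theorem dirichletRightUnitorHom_day (p : PolyFunctor.{u}) {A B : Type u} (x : p.ev A)
    (b : y.ev B) :
    app (dirichletRightUnitorHom p) _ (day x b) = p.act (fun a => (a, val b)) x :=
  app_desc_day _ (fun f g x b => by simp only [act_act, val_act]) x b

/-- The right unitor of the Dirichlet product. -/
noncomputable def dirichletRightUnitor (p : PolyFunctor.{u}) : dirichlet p y ≅ p where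
  hom := dirichletRightUnitorHom p
  inv := mkHom (fun A x => (dirichlet p y).act (fun t => t.1) (day x pt))
    (fun A B f x => by rw [day_act_left, act_act, act_act])
  hom_inv_id := dirichlet_ext fun A B x b => by
    conv_rhs => rw [← act_pt b]
    simp only [app_comp, app_id, dirichletRightUnitorHom_day, app_mkHom, day_act_right,
      day_act_left, act_act]
  inv_hom_id := hom_ext' fun A x => by
    simp only [app_comp, app_id, dirichletRightUnitorHom_day, app_mkHom, app_act, act_act, act_id]

/-- The monoidal structure `(Poly, y, ⊗)` induced by Day convolution from the cartesian product
of sets. -/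
@[reducible]
noncomputable def dirichletProduct : MonoidalCategory PolyFunctor.{u} where
  tensorObj := dirichlet
  tensorHom φ ψ := dirichletMap φ ψ
  whiskerLeft p _ _ ψ := dirichletMap (𝟙 p) ψ
  whiskerRight φ q := dirichletMap φ (𝟙 q)
  tensorUnit := y
  associator := dirichletAssoc
  leftUnitor := dirichletLeftUnitor
  rightUnitor := dirichletRightUnitor
  tensorHom_def φ ψ := dirichlet_ext fun A B x z => by
    simp only [app_comp, dirichletMap_day, app_id]
  id_tensorHom_id p q := dirichlet_ext fun A B x z => by
    simp only [dirichletMap_day, app_id]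
  tensorHom_comp_tensorHom f g h k := dirichlet_ext fun A B x z => by
    simp only [app_comp, dirichletMap_day]
  whiskerLeft_id p q := dirichlet_ext fun A B x z => by
    simp only [dirichletMap_day, app_id]
  id_whiskerRight p q := dirichlet_ext fun A B x z => by
    simp only [dirichletMap_day, app_id]
  associator_naturality φ ψ χ := dirichlet_ext_left fun A B C x z w => by
    simp only [dirichletAssoc, app_comp, dirichletMap_day, dirichletAssocHom_day, app_act]
  leftUnitor_naturality φ := dirichlet_ext fun A B a z => by
    simp only [dirichletLeftUnitor, app_comp, dirichletMap_day, app_id,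
      dirichletLeftUnitorHom_day, app_act]
  rightUnitor_naturality φ := dirichlet_ext fun A B x b => by
    simp only [dirichletRightUnitor, app_comp, dirichletMap_day, app_id,
      dirichletRightUnitorHom_day, app_act]
  pentagon p q r s := dirichlet_ext_left' fun A B C D x z w v => by
    simp only [dirichletAssoc, app_comp, dirichletMap_day, app_id, dirichletAssocHom_day, app_act,
      act_act, day_act_left, day_act_right]
  triangle p q := dirichlet_ext_left fun A B C x b z => by
    simp only [dirichletAssoc, dirichletLeftUnitor, dirichletRightUnitor, app_comp,
      dirichletMap_day, app_id, dirichletAssocHom_day, dirichletLeftUnitorHom_day,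
      dirichletRightUnitorHom_day, app_act, act_act, day_act_left, day_act_right]

end PolyFunctor

/-!
The linear and permuting distributors exist because of two features of functors `Set ⥤ Set`.

* A map out of `p ⊗ q` is the same as a family `p(A) × q(B) → r(A × B)` natural in `A` and `B`
  (universal property of Day convolution: `desc`, `app_desc_day`, `dirichlet_ext`), with universal
  family written `day x z`.
* Every functor `p : Set ⥤ Set` has a canonical strength `A × p(B) → p(A × B)`,
  `(α, s) ↦ p(β ↦ (α, β))(s)`, and dually a costrength.

For `x ∈ a(A)` and `z ∈ b(c(B))` there are two ways to produce an element of a composite functor at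
`A × B`. Either `x` is paired with the outer layer of `z`, giving an element of
`(a ⊗ b)(A × c(B))`, and the strength of `c` is applied inside; this is the distributor into
`(a ⊗ b) ◁ c` (`distL_day`). Or `x` is paired with every inner value `t ∈ c(B)` of `z` separately,
by applying `b` to `t ↦ day x t`; this is the distributor into `b ◁ (a ⊗ c)` (`distLR_day`). With the
factors of `⊗` interchanged one obtains `distRL_day` and `distR_day`. No symmetry of `⊗` is used.

By the universal property, every coherence condition is an equation between values at elements
`day x z` or `day (day x z) w`, where the factors of the form `p ◁ q` are evaluated at elements of
`p(q(A))`. On such elements all the maps involved are given by explicit formulas, and both sides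
reduce to the same expression by functoriality and the naturality of `day`. The two products have
the same unit `y`, and the mix map is its identity: both composites `a ⊗ b ⟶ a ◁ b` send `day x z`
to `a(α ↦ b(β ↦ (α, β))(z))(x)`.

The Dirichlet product is written `⊠` in the code. The coherence lemmas are stated with `dirichlet`,
`subst` and their actions on morphisms in place of the projections of the two `MonoidalCategory`
structures, which are definitionally equal to them but would not match the rewriting lemmas.
-/

namespace PolyFunctor

/-! ### Elements of the substitution product -/

local infix:70 " ⊠ " => dirichlet
local infix:70 " ◁ " => subst

/-- An element of `p(q(A))`, regarded as an element of `(p ◁ q)(A)`. The two types agree by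
definition; the explicit map records in which of the two functors an element is meant to be acted
on, which rewriting along `act` and `day` depends on. -/
def substMk {p q : PolyFunctor.{u}} {A : Type u} (x : p.ev (q.ev A)) : (p ◁ q).ev A := x

/-- An element of `A`, regarded as an element of `y(A)`; the inverse of `val`. -/
def ofVal {A : Type u} (a : A) : y.ev A := a

theorem val_ofVal {A : Type u} (a : A) : val (ofVal a) = a := rfl

theorem act_substMk {p q : PolyFunctor.{u}} {A B : Type u} (f : A → B) (x : p.ev (q.ev A)) :
    (p ◁ q).act f (substMk x) = substMk (p.act (q.act f) x) := rfl

theorem substMap_substMk {p p' q q' : PolyFunctor.{u}} (φ : p ⟶ p') (ψ : q ⟶ q') {A : Type u}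
    (x : p.ev (q.ev A)) :
    app (substMap φ ψ) A (substMk x) = substMk (p'.act (app ψ A) (app φ (q.ev A) x)) := rfl

/-- Every element of `(p ◁ q)(A)` is of the form `substMk x`; this is the induction principle that
puts elements in that form. -/
theorem substMk_ind {p q : PolyFunctor.{u}} {A : Type u} {P : (p ◁ q).ev A → Prop}
    (h : ∀ x, P (substMk x)) (x : (p ◁ q).ev A) : P x := h x

/-- The associator of the substitution product, with its source and target written in terms of
`subst`. -/
def substAssoc (p q r : PolyFunctor.{u}) : (p ◁ q) ◁ r ≅ p ◁ (q ◁ r) :=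
  ObjectProperty.isoMk _ (Functor.associator r.obj q.obj p.obj).symm

/-- The left unitor of the substitution product. -/
def substLeftUnitor (p : PolyFunctor.{u}) : y ◁ p ≅ p :=
  ObjectProperty.isoMk _ (Functor.rightUnitor p.obj)

/-- The right unitor of the substitution product. -/
def substRightUnitor (p : PolyFunctor.{u}) : p ◁ y ≅ p :=
  ObjectProperty.isoMk _ (Functor.leftUnitor p.obj)

theorem substAssoc_hom_substMk (p q r : PolyFunctor.{u}) {A : Type u} (x : p.ev (q.ev (r.ev A))) :
    app (substAssoc p q r).hom A (substMk (substMk x)) = substMk (p.act substMk x) :=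
  (p.act_id x).symm

theorem substLeftUnitor_hom_substMk (p : PolyFunctor.{u}) {A : Type u} (x : y.ev (p.ev A)) :
    app (substLeftUnitor p).hom A (substMk x) = val x := rfl

theorem substLeftUnitor_inv_app (p : PolyFunctor.{u}) {A : Type u} (x : p.ev A) :
    app (substLeftUnitor p).inv A x = substMk (ofVal x) := rfl

theorem substRightUnitor_hom_substMk (p : PolyFunctor.{u}) {A : Type u} (x : p.ev (y.ev A)) :
    app (substRightUnitor p).hom A (substMk x) = p.act val x := (p.act_id x).symm

theorem substRightUnitor_inv_app (p : PolyFunctor.{u}) {A : Type u} (x : p.ev A) :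
    app (substRightUnitor p).inv A x = substMk (p.act ofVal x) := (p.act_id x).symm

/-! ### The four distributors -/

/-- The left linear distributor: `x ∈ a(A)` is paired with the outer layer of `z ∈ b(c(B))`, and the
strength of `c` moves `A` inside. -/
noncomputable def distL (a b c : PolyFunctor.{u}) :
    a ⊠ (b ◁ c) ⟶ (a ⊠ b) ◁ c :=
  desc fun {_ B} x z => substMk ((a ⊠ b).act (fun t => c.act (fun s => (t.1, s)) t.2)
    (day x (show b.ev (c.ev B) from z)))

/-- The right linear distributor: `x ∈ a(A)` is paired, on the right, with each inner value of
`z ∈ b(c(B))`. -/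
noncomputable def distR (b c a : PolyFunctor.{u}) :
    (b ◁ c) ⊠ a ⟶ b ◁ (c ⊠ a) :=
  desc fun z x => substMk (b.act (fun t => day t x) z)

/-- The left permuting distributor: `x ∈ a(A)` is paired, on the left, with each inner value of
`z ∈ b(c(B))`. -/
noncomputable def distLR (a b c : PolyFunctor.{u}) :
    a ⊠ (b ◁ c) ⟶ b ◁ (a ⊠ c) :=
  desc fun x z => substMk (b.act (fun t => day x t) z)

/-- The right permuting distributor: `x ∈ a(A)` is paired with the outer layer of `z ∈ b(c(B))`, and
the costrength of `c` moves `A` inside. -/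
noncomputable def distRL (b c a : PolyFunctor.{u}) :
    (b ◁ c) ⊠ a ⟶ (b ⊠ a) ◁ c :=
  desc fun {A _} z x => substMk ((b ⊠ a).act (fun t => c.act (fun s => (s, t.2)) t.1)
    (day (show b.ev (c.ev A) from z) x))

theorem distL_day (a b c : PolyFunctor.{u}) {A B : Type u} (x : a.ev A) (z : b.ev (c.ev B)) :
    app (distL a b c) (A × B) (day x (substMk z)) =
      substMk ((a ⊠ b).act (fun t => c.act (fun s => (t.1, s)) t.2) (day x z)) := by
  refine app_desc_day _ (fun {A B A' B'} f g x z => ?_) x (substMk z)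
  induction z using substMk_ind with | h z =>
  -- Acting on `substMk z` acts on `z` through `b.act (c.act g)`; both sides have to show this
  -- before `day_act_right` applies.
  change substMk ((a ⊠ b).act _ (day _ (b.act (c.act g) z))) =
    ((a ⊠ b) ◁ c).act _ (substMk ((a ⊠ b).act _ (day _ z)))
  simp only [act_substMk, day_act_left, day_act_right, act_act]

theorem distR_day (b c a : PolyFunctor.{u}) {A B : Type u} (z : b.ev (c.ev B)) (x : a.ev A) :
    app (distR b c a) (B × A) (day (substMk z) x) = substMk (b.act (fun t => day t x) z) := by
  refine app_desc_day _ (fun {A B A' B'} f g z x => ?_) (substMk z) x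
  induction z using substMk_ind with | h z =>
  change substMk (b.act _ (b.act (c.act f) z)) = (b ◁ (c ⊠ a)).act _ (substMk (b.act _ z))
  simp only [act_substMk, day_act_left, day_act_right, act_act]

theorem distLR_day (a b c : PolyFunctor.{u}) {A B : Type u} (x : a.ev A) (z : b.ev (c.ev B)) :
    app (distLR a b c) (A × B) (day x (substMk z)) = substMk (b.act (fun t => day x t) z) := by
  refine app_desc_day _ (fun {A B A' B'} f g x z => ?_) x (substMk z)
  induction z using substMk_ind with | h z =>
  change substMk (b.act _ (b.act (c.act g) z)) = (b ◁ (a ⊠ c)).act _ (substMk (b.act _ z))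
  simp only [act_substMk, day_act_left, day_act_right, act_act]

theorem distRL_day (b c a : PolyFunctor.{u}) {A B : Type u} (z : b.ev (c.ev B)) (x : a.ev A) :
    app (distRL b c a) (B × A) (day (substMk z) x) =
      substMk ((b ⊠ a).act (fun t => c.act (fun s => (s, t.2)) t.1) (day z x)) := by
  refine app_desc_day _ (fun {A B A' B'} f g z x => ?_) (substMk z) x
  induction z using substMk_ind with | h z =>
  change substMk ((b ⊠ a).act _ (day (b.act (c.act f) z) _)) =
    ((b ⊠ a) ◁ c).act _ (substMk ((b ⊠ a).act _ (day z _)))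
  simp only [act_substMk, day_act_left, day_act_right, act_act]

/-! ### Coherence of the linear distributors -/

theorem distL_natural {a b c a' b' c' : PolyFunctor.{u}} (f : a ⟶ a') (g : b ⟶ b') (h : c ⟶ c') :
    dirichletMap f (substMap g h) ≫ distL a' b' c' =
      distL a b c ≫ substMap (dirichletMap f g) h := by
  refine dirichlet_ext fun A B x z => ?_
  induction z using substMk_ind with | h z =>
  simp only [app_comp, app_act, act_act, dirichletMap_day, substMap_substMk, day_act_right,
    distL_day]

theorem distR_natural {b c a b' c' a' : PolyFunctor.{u}} (g : b ⟶ b') (h : c ⟶ c') (f : a ⟶ a') :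
    dirichletMap (substMap g h) f ≫ distR b' c' a' =
      distR b c a ≫ substMap g (dirichletMap h f) := by
  refine dirichlet_ext fun A B z x => ?_
  induction z using substMk_ind with | h z =>
  simp only [app_comp, app_act, act_act, dirichletMap_day, substMap_substMk, distR_day]

theorem distL_top (b c : PolyFunctor.{u}) :
    distL y b c ≫ substMap (dirichletLeftUnitor b).hom (𝟙 c) =
      (dirichletLeftUnitor (b ◁ c)).hom := by
  refine dirichlet_ext fun A B x z => ?_
  induction z using substMk_ind with | h z =>
  simp only [dirichletLeftUnitor, app_comp, app_id_fun, app_act, act_act, act_substMk,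
    substMap_substMk, dirichletLeftUnitorHom_day, distL_day]

theorem distL_bot (a b : PolyFunctor.{u}) :
    distL a b y ≫ (substRightUnitor (a ⊠ b)).hom =
      dirichletMap (𝟙 a) (substRightUnitor b).hom := by
  refine dirichlet_ext fun A B x z => ?_
  induction z using substMk_ind with | h z =>
  simp only [app_comp, app_id, act_act, dirichletMap_day, day_act_right,
    substRightUnitor_hom_substMk, val_act, distL_day]

theorem distR_top (b c : PolyFunctor.{u}) :
    distR b c y ≫ substMap (𝟙 b) (dirichletRightUnitor c).hom =
      (dirichletRightUnitor (b ◁ c)).hom := by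
  refine dirichlet_ext fun A B z x => ?_
  induction z using substMk_ind with | h z =>
  simp only [dirichletRightUnitor, app_comp, app_id, app_act, act_act, act_substMk,
    substMap_substMk, dirichletRightUnitorHom_day, distR_day]

theorem distR_bot (c a : PolyFunctor.{u}) :
    distR y c a ≫ (substLeftUnitor (c ⊠ a)).hom =
      dirichletMap (substLeftUnitor c).hom (𝟙 a) := by
  refine dirichlet_ext fun A B z x => ?_
  induction z using substMk_ind with | h z =>
  simp only [app_comp, app_id, dirichletMap_day, substLeftUnitor_hom_substMk, val_act, distR_day]

theorem distL_assoc_tensor (a b c d : PolyFunctor.{u}) :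
    distL (a ⊠ b) c d ≫ substMap (dirichletAssoc a b c).hom (𝟙 d) =
      (dirichletAssoc a b (c ◁ d)).hom ≫ dirichletMap (𝟙 a) (distL b c d) ≫
        distL a (b ⊠ c) d := by
  refine dirichlet_ext_left fun A B C x w z => ?_
  induction z using substMk_ind with | h z =>
  simp only [dirichletAssoc, app_comp, app_id, app_id_fun, app_act, act_act, act_substMk,
    dirichletMap_day, substMap_substMk, day_act_right, dirichletAssocHom_day, distL_day]

theorem distR_assoc_tensor (c d a b : PolyFunctor.{u}) :
    dirichletMap (distR c d a) (𝟙 b) ≫ distR c (d ⊠ a) b ≫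
        substMap (𝟙 c) (dirichletAssoc d a b).hom =
      (dirichletAssoc (c ◁ d) a b).hom ≫ distR c d (a ⊠ b) := by
  refine dirichlet_ext_left fun A B C z x w => ?_
  induction z using substMk_ind with | h z =>
  simp only [dirichletAssoc, app_comp, app_id, app_act, act_act, act_substMk, dirichletMap_day,
    substMap_substMk, dirichletAssocHom_day, distR_day]

theorem distL_assoc_seq (a b c d : PolyFunctor.{u}) :
    distL a (b ◁ c) d ≫ substMap (distL a b c) (𝟙 d) ≫
        (substAssoc (a ⊠ b) c d).hom =
      dirichletMap (𝟙 a) (substAssoc b c d).hom ≫ distL a b (c ◁ d) := by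
  refine dirichlet_ext fun A B x z => ?_
  induction z using substMk_ind with | h z =>
  induction z using substMk_ind with | h z =>
  simp only [app_comp, app_id, app_id_fun, app_act, act_act, act_id, act_substMk, dirichletMap_day,
    substMap_substMk, day_act_right, substAssoc_hom_substMk, distL_day]

theorem distR_assoc_seq (b c d a : PolyFunctor.{u}) :
    distR (b ◁ c) d a ≫ (substAssoc b c (d ⊠ a)).hom =
      dirichletMap (substAssoc b c d).hom (𝟙 a) ≫ distR b (c ◁ d) a ≫
        substMap (𝟙 b) (distR c d a) := by
  refine dirichlet_ext fun A B z x => ?_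
  induction z using substMk_ind with | h z =>
  induction z using substMk_ind with | h z =>
  simp only [app_comp, app_id, app_act, act_act, act_substMk, dirichletMap_day, substMap_substMk,
    substAssoc_hom_substMk, distR_day]

theorem distL_distR_tensor (a b c d : PolyFunctor.{u}) :
    dirichletMap (distL a b c) (𝟙 d) ≫ distR (a ⊠ b) c d =
      (dirichletAssoc a (b ◁ c) d).hom ≫ dirichletMap (𝟙 a) (distR b c d) ≫
        distL a b (c ⊠ d) := by
  refine dirichlet_ext_left fun A B C x z w => ?_
  induction z using substMk_ind with | h z =>
  simp only [dirichletAssoc, app_comp, app_id, app_act, act_act, act_substMk, dirichletMap_day,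
    day_act_left, day_act_right, dirichletAssocHom_day, distL_day, distR_day]

theorem distL_distR_seq (a b c d : PolyFunctor.{u}) :
    distL (a ◁ b) c d ≫ substMap (distR a b c) (𝟙 d) ≫
        (substAssoc a (b ⊠ c) d).hom =
      distR a b (c ◁ d) ≫ substMap (𝟙 a) (distL b c d) := by
  refine dirichlet_ext fun A B x z => ?_
  induction x using substMk_ind with | h x =>
  induction z using substMk_ind with | h z =>
  simp only [app_comp, app_id, app_id_fun, app_act, act_act, act_id, act_substMk, substMap_substMk,
    substAssoc_hom_substMk, distL_day, distR_day]

/-! ### Coherence of the permuting distributors -/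

theorem distLR_natural {a b c a' b' c' : PolyFunctor.{u}} (f : a ⟶ a') (g : b ⟶ b') (h : c ⟶ c') :
    dirichletMap f (substMap g h) ≫ distLR a' b' c' =
      distLR a b c ≫ substMap g (dirichletMap f h) := by
  refine dirichlet_ext fun A B x z => ?_
  induction z using substMk_ind with | h z =>
  simp only [app_comp, app_act, act_act, dirichletMap_day, substMap_substMk, distLR_day]

theorem distRL_natural {b c a b' c' a' : PolyFunctor.{u}} (g : b ⟶ b') (h : c ⟶ c') (f : a ⟶ a') :
    dirichletMap (substMap g h) f ≫ distRL b' c' a' =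
      distRL b c a ≫ substMap (dirichletMap g f) h := by
  refine dirichlet_ext fun A B z x => ?_
  induction z using substMk_ind with | h z =>
  simp only [app_comp, app_act, act_act, dirichletMap_day, substMap_substMk, day_act_left,
    distRL_day]

theorem distLR_top (b c : PolyFunctor.{u}) :
    distLR y b c ≫ substMap (𝟙 b) (dirichletLeftUnitor c).hom =
      (dirichletLeftUnitor (b ◁ c)).hom := by
  refine dirichlet_ext fun A B x z => ?_
  induction z using substMk_ind with | h z =>
  simp only [dirichletLeftUnitor, app_comp, app_id, app_act, act_act, act_substMk, substMap_substMk,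
    dirichletLeftUnitorHom_day, distLR_day]

theorem distLR_bot (a c : PolyFunctor.{u}) :
    distLR a y c ≫ (substLeftUnitor (a ⊠ c)).hom =
      dirichletMap (𝟙 a) (substLeftUnitor c).hom := by
  refine dirichlet_ext fun A B x z => ?_
  induction z using substMk_ind with | h z =>
  simp only [app_comp, app_id, dirichletMap_day, substLeftUnitor_hom_substMk, val_act, distLR_day]

theorem distRL_top (b c : PolyFunctor.{u}) :
    distRL b c y ≫ substMap (dirichletRightUnitor b).hom (𝟙 c) =
      (dirichletRightUnitor (b ◁ c)).hom := by
  refine dirichlet_ext fun A B z x => ?_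
  induction z using substMk_ind with | h z =>
  simp only [dirichletRightUnitor, app_comp, app_id_fun, app_act, act_act, act_substMk,
    substMap_substMk, dirichletRightUnitorHom_day, distRL_day]

theorem distRL_bot (b a : PolyFunctor.{u}) :
    distRL b y a ≫ (substRightUnitor (b ⊠ a)).hom =
      dirichletMap (substRightUnitor b).hom (𝟙 a) := by
  refine dirichlet_ext fun A B z x => ?_
  induction z using substMk_ind with | h z =>
  simp only [app_comp, app_id, act_act, dirichletMap_day, day_act_left,
    substRightUnitor_hom_substMk, val_act, distRL_day]

theorem distLR_assoc_tensor (a b c d : PolyFunctor.{u}) :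
    distLR (a ⊠ b) c d ≫ substMap (𝟙 c) (dirichletAssoc a b d).hom =
      (dirichletAssoc a b (c ◁ d)).hom ≫ dirichletMap (𝟙 a) (distLR b c d) ≫
        distLR a c (b ⊠ d) := by
  refine dirichlet_ext_left fun A B C x w z => ?_
  induction z using substMk_ind with | h z =>
  simp only [dirichletAssoc, app_comp, app_id, app_act, act_act, act_substMk, dirichletMap_day,
    substMap_substMk, dirichletAssocHom_day, distLR_day]

theorem distRL_assoc_tensor (c d a b : PolyFunctor.{u}) :
    dirichletMap (distRL c d a) (𝟙 b) ≫ distRL (c ⊠ a) d b ≫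
        substMap (dirichletAssoc c a b).hom (𝟙 d) =
      (dirichletAssoc (c ◁ d) a b).hom ≫ distRL c d (a ⊠ b) := by
  refine dirichlet_ext_left fun A B C z x w => ?_
  induction z using substMk_ind with | h z =>
  simp only [dirichletAssoc, app_comp, app_id, app_id_fun, app_act, act_act, act_substMk,
    dirichletMap_day, substMap_substMk, day_act_left, dirichletAssocHom_day, distRL_day]

theorem distL_distRL_tensor (a b c d : PolyFunctor.{u}) :
    dirichletMap (distL a b c) (𝟙 d) ≫ distRL (a ⊠ b) c d ≫
        substMap (dirichletAssoc a b d).hom (𝟙 c) =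
      (dirichletAssoc a (b ◁ c) d).hom ≫ dirichletMap (𝟙 a) (distRL b c d) ≫
        distL a (b ⊠ d) c := by
  refine dirichlet_ext_left fun A B C x z w => ?_
  induction z using substMk_ind with | h z =>
  simp only [dirichletAssoc, app_comp, app_id, app_id_fun, app_act, act_act, act_substMk,
    dirichletMap_day, substMap_substMk, day_act_left, day_act_right, dirichletAssocHom_day,
    distL_day, distRL_day]

theorem distLR_distR_tensor (a b c d : PolyFunctor.{u}) :
    dirichletMap (distLR a b c) (𝟙 d) ≫ distR b (a ⊠ c) d ≫
        substMap (𝟙 b) (dirichletAssoc a c d).hom =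
      (dirichletAssoc a (b ◁ c) d).hom ≫ dirichletMap (𝟙 a) (distR b c d) ≫
        distLR a b (c ⊠ d) := by
  refine dirichlet_ext_left fun A B C x z w => ?_
  induction z using substMk_ind with | h z =>
  simp only [dirichletAssoc, app_comp, app_id, app_act, act_act, act_substMk, dirichletMap_day,
    substMap_substMk, dirichletAssocHom_day, distR_day, distLR_day]

theorem distLR_distRL_tensor (a b c d : PolyFunctor.{u}) :
    dirichletMap (distLR a b c) (𝟙 d) ≫ distRL b (a ⊠ c) d =
      (dirichletAssoc a (b ◁ c) d).hom ≫ dirichletMap (𝟙 a) (distRL b c d) ≫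
        distLR a (b ⊠ d) c := by
  refine dirichlet_ext_left fun A B C x z w => ?_
  induction z using substMk_ind with | h z =>
  simp only [dirichletAssoc, app_comp, app_id, app_act, act_act, act_substMk, dirichletMap_day,
    day_act_left, day_act_right, dirichletAssocHom_day, distLR_day, distRL_day]

theorem distLR_assoc_seq (a b c d : PolyFunctor.{u}) :
    distLR a (b ◁ c) d ≫ (substAssoc b c (a ⊠ d)).hom =
      dirichletMap (𝟙 a) (substAssoc b c d).hom ≫ distLR a b (c ◁ d) ≫
        substMap (𝟙 b) (distLR a c d) := by
  refine dirichlet_ext fun A B x z => ?_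
  induction z using substMk_ind with | h z =>
  induction z using substMk_ind with | h z =>
  simp only [app_comp, app_id, app_act, act_act, act_substMk, dirichletMap_day, substMap_substMk,
    substAssoc_hom_substMk, distLR_day]

theorem distRL_assoc_seq (b c d a : PolyFunctor.{u}) :
    distRL (b ◁ c) d a ≫ substMap (distRL b c a) (𝟙 d) ≫
        (substAssoc (b ⊠ a) c d).hom =
      dirichletMap (substAssoc b c d).hom (𝟙 a) ≫ distRL b (c ◁ d) a := by
  refine dirichlet_ext fun A B z x => ?_
  induction z using substMk_ind with | h z =>
  induction z using substMk_ind with | h z =>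
  simp only [app_comp, app_id, app_id_fun, app_act, act_act, act_id, act_substMk, dirichletMap_day,
    substMap_substMk, day_act_left, substAssoc_hom_substMk, distRL_day]

theorem distL_distLR_seq (a b c d : PolyFunctor.{u}) :
    distL a (b ◁ c) d ≫ substMap (distLR a b c) (𝟙 d) ≫
        (substAssoc b (a ⊠ c) d).hom =
      dirichletMap (𝟙 a) (substAssoc b c d).hom ≫ distLR a b (c ◁ d) ≫
        substMap (𝟙 b) (distL a c d) := by
  refine dirichlet_ext fun A B x z => ?_
  induction z using substMk_ind with | h z =>
  induction z using substMk_ind with | h z =>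
  simp only [app_comp, app_id, app_id_fun, app_act, act_act, act_id, act_substMk, dirichletMap_day,
    substMap_substMk, substAssoc_hom_substMk, distL_day, distLR_day]

theorem distR_distRL_seq (b c d a : PolyFunctor.{u}) :
    distRL (b ◁ c) d a ≫ substMap (distR b c a) (𝟙 d) ≫
        (substAssoc b (c ⊠ a) d).hom =
      dirichletMap (substAssoc b c d).hom (𝟙 a) ≫ distR b (c ◁ d) a ≫
        substMap (𝟙 b) (distRL c d a) := by
  refine dirichlet_ext fun A B z x => ?_
  induction z using substMk_ind with | h z =>
  induction z using substMk_ind with | h z =>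
  simp only [app_comp, app_id, app_id_fun, app_act, act_act, act_id, act_substMk, dirichletMap_day,
    substMap_substMk, substAssoc_hom_substMk, distR_day, distRL_day]

theorem distLR_distRL_seq (a b c d : PolyFunctor.{u}) :
    distRL a b (c ◁ d) ≫ substMap (distLR a c d) (𝟙 b) ≫
        (substAssoc c (a ⊠ d) b).hom =
      distLR (a ◁ b) c d ≫ substMap (𝟙 c) (distRL a b d) := by
  refine dirichlet_ext fun A B x z => ?_
  induction x using substMk_ind with | h x =>
  induction z using substMk_ind with | h z =>
  simp only [app_comp, app_id, app_id_fun, app_act, act_act, act_id, act_substMk, substMap_substMk,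
    substAssoc_hom_substMk, distLR_day, distRL_day]

/-! ### The isomix non-planar linearly distributive structure -/

/-- The linearly distributive structure of `(Poly, y, ⊗, ◁)`. -/
noncomputable def ldc : LDC PolyFunctor.{u} dirichletProduct substitution where
  distL := distL
  distR := distR
  distL_natural := distL_natural
  distR_natural := distR_natural
  distL_top := distL_top
  distL_bot := distL_bot
  distR_top := distR_top
  distR_bot := distR_bot
  distL_assoc_tensor := distL_assoc_tensor
  distR_assoc_tensor := distR_assoc_tensor
  distL_assoc_seq := distL_assoc_seq
  distR_assoc_seq := distR_assoc_seq
  distL_distR_tensor := distL_distR_tensor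
  distL_distR_seq := distL_distR_seq

/-- The non-planar linearly distributive structure of `(Poly, y, ⊗, ◁)`. -/
noncomputable def nonplanarLDC :
    NonplanarLDC PolyFunctor.{u} dirichletProduct substitution where
  toLDC := ldc
  distLR := distLR
  distRL := distRL
  distLR_natural := distLR_natural
  distRL_natural := distRL_natural
  distLR_top := distLR_top
  distLR_bot := distLR_bot
  distRL_top := distRL_top
  distRL_bot := distRL_bot
  distLR_assoc_tensor := distLR_assoc_tensor
  distRL_assoc_tensor := distRL_assoc_tensor
  distL_distRL_tensor := distL_distRL_tensor
  distLR_distR_tensor := distLR_distR_tensor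
  distLR_distRL_tensor := distLR_distRL_tensor
  distLR_assoc_seq := distLR_assoc_seq
  distRL_assoc_seq := distRL_assoc_seq
  distL_distLR_seq := distL_distLR_seq
  distR_distRL_seq := distR_distRL_seq
  distLR_distRL_seq := distLR_distRL_seq

/-- The identity of the common unit `y` is a mix map: both sides send `day x z` to
`a(α ↦ b(β ↦ (α, β))(z))(x)`. -/
theorem mix_id (a b : PolyFunctor.{u}) :
    dirichletMap (𝟙 a) (substLeftUnitor b).inv ≫ dirichletMap (𝟙 a) (substMap (𝟙 y) (𝟙 b)) ≫
        distL a y b ≫ substMap (dirichletRightUnitor a).hom (𝟙 b) =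
      dirichletMap (substRightUnitor a).inv (𝟙 b) ≫ distR a y b ≫
        substMap (𝟙 a) (dirichletMap (𝟙 y) (𝟙 b)) ≫ substMap (𝟙 a) (dirichletLeftUnitor b).hom := by
  refine dirichlet_ext fun A B x z => ?_
  simp only [substLeftUnitor_inv_app, substRightUnitor_inv_app, val_ofVal, dirichletLeftUnitor,
    dirichletRightUnitor, app_comp, app_id, app_id_fun, app_act, act_act, act_id, dirichletMap_day,
    substMap_substMk, dirichletLeftUnitorHom_day, dirichletRightUnitorHom_day, distL_day, distR_day]

end PolyFunctor

theorem corollary3p5 :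
    ∃ (L : NonplanarLDC PolyFunctor.{u} PolyFunctor.dirichletProduct PolyFunctor.substitution)
      (m : PolyFunctor.substitution.tensorUnit ⟶ PolyFunctor.dirichletProduct.tensorUnit),
      L.toLDC.IsMixMap m ∧ IsIso m :=
  ⟨PolyFunctor.nonplanarLDC, 𝟙 PolyFunctor.y, PolyFunctor.mix_id, IsIso.id PolyFunctor.y⟩
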